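/- **Theorem.** In neutral constructive geometry of the plane, the strong parallel postulate implies Euclid's Postulate 5. That is, the formula $\mathrm{SPP}\rightarrow\mathrm{Euclid\,5}$ is derivable from the axioms of neutral constructive geometry listed below, in intuitionistic first-order logic with equality. **Language.** Variables range over points; the primitive relations are equality, strict betweenness ${\bf B}(a,b,c)$ ("$b$ is strictly between $a$ and $c$") and segment congruence $ab=cd$. Abbreviations: - ${\bf T}(a,b,c) := \neg(a\neq b\land b\neq c\land\neg{\bf B}(a,b,c))$ (non-strict betweenness); - $Col(a,b,c) := \neg(\neg{\bf T}(a,b,c)\land\neg{\bf T}(b,c,a)\land\neg{\bf T}(c,a,b))$; - $ab\le cd := \exists e\,({\bf T}(c,e,d)\land ab=ce)$; - for $a\neq b$, $on(x,Line(a,b)) := \neg\neg({\bf B}(a,b,x)\lor{\bf B}(b,x,a)\lor{\bf B}(x,a,b)\lor x=a\lor x=b)$; - $e=IntersectLines(Line(a,b),Line(c,d))$ means: $a\neq b$, $c\neq d$, not both $c$ and $d$ lie on $Line(a,b)$, and $e$ lies on both lines. **Axioms of neutral constructive geometry** (universally closed; no parallel postulate): - stability: $\neg\neg\,a=b\rightarrow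 a=b$; $\ \neg\neg{\bf B}(a,b,c)\rightarrow{\bf B}(a,b,c)$ (Markov's principle for betweenness); $\ \neg\neg\,ab=cd\rightarrow ab=cd$; - congruence: $ab=ba$; $\ ab=pq\land ab=rs\rightarrow pq=rs$; $\ ab=cc\rightarrow a=b$; - segment extension: $a\neq b\rightarrow\exists x\,({\bf T}(a,b,x)\land bx=cd)$; - five-segment axiom: $a\ne b\land{\bf T}(a,b,c)\land{\bf T}(a',b',c')\land ab=a'b'\land bc=b'c'\land ad=a'd'\land bd=b'd'\rightarrow cd=c'd'$; - betweenness: $\neg{\bf B}(a,b,a)$; $\ {\bf B}(a,b,c)\rightarrow{\bf B}(c,b,a)$; $\ {\bf B}(a,b,d)\land{\bf B}(b,c,d)\rightarrow{\bf B}(a,b,c)$; - inner Pasch: ${\bf B}(a,p,c)\land{\bf B}(b,q,c)\land\neg Col(a,b,c)\rightarrow\exists x\,({\bf B}(p,x,b)\land{\bf B}(q,x,a))$; - outer Pasch: ${\bf B}(a,p,c)\land{\bf B}(b,c,q)\land\neg Col(a,b,q)\rightarrow\exists x\,({\bf B}(a,x,q)\land{\bf B}(b,p,x))$; - dimension: $\exists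 a\,b\,c\,\neg Col(a,b,c)$; $\ p\neq q\land ap=aq\land bp=bq\land cp=cq\rightarrow Col(a,b,c)$; - line-circle continuity: $a\neq b\land ca\le cd\land cd\le cb\rightarrow\exists x\,({\bf T}(a,x,b)\land cx=cd)$; - circle-circle continuity: $c\neq k\land cu=cd\land cv=cd\land ku\le kl\land kl\le kv\rightarrow\exists x\,(cx=cd\land kx=kl)$. **Strong parallel postulate (SPP).** For all points $p,q,r,s,t,a$ with $s\ne q$, $p\ne a$, $p\neq r$, put $L=Line(s,q)$, $M=Line(p,a)$, $K=Line(p,r)$. If ${\bf B}(p,t,q)$, ${\bf B}(s,t,r)$, $\neg on(p,L)$, $\neg on(a,K)$, $pt=qt$ and $rt=st$, then $IntersectLines(L,M)$ exists, that is, there is a point $e=IntersectLines(L,M)$ with $on(e,L)\land on(e,M)$. **Euclid 5.** For all points $p,q,r,s,t,a$ with $s\ne q$, $p\ne a$, $p\neq r$, put $L=Line(s,q)$, $M=Line(p,a)$. If ${\bf B}(q,a,r)$, ${\bf B}(p,t,q)$, ${\bf B}(s,t,r)$, $pt=qt$, $rt=st$ and $\neg on(p,L)$, then $IntersectLines(L,M)$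 exists and lies on the correct side: there is a point $e=IntersectLines(L,M)$ with ${\bf B}(p,a,e)\land{\bf B}(s,q,e)$. -/

import Mathlib

namespace ConstructiveGeometry

/-! ## First-order language of points

The only sort is that of points; the primitive relations are equality, strict betweenness and
segment congruence.  Variables are de Bruijn indices: under a quantifier the index `0` is the
variable just bound, and every other variable has its index raised by one. -/

inductive Formula : Type where
  | falsum : Formula
  | eq (a b : ℕ) : Formula
  /-- `betw a b c`: the point `b` is strictly between `a` and `c`. -/
  | betw (a b c : ℕ) : Formula
  /-- `cong a b c d`: the segments `ab` and `cd` are congruent, `ab = cd`. -/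
  | cong (a b c d : ℕ) : Formula
  | and (φ ψ : Formula) : Formula
  | or (φ ψ : Formula) : Formula
  | imp (φ ψ : Formula) : Formula
  | all (φ : Formula) : Formula
  | ex (φ : Formula) : Formula

infixr:60 " ⋏ " => Formula.and
infixr:55 " ⋎ " => Formula.or
infixr:50 " ⇾ " => Formula.imp

namespace Formula

/-- Negation is implication of absurdity. -/
def neg (φ : Formula) : Formula := φ ⇾ falsum

/-- `a ≠ b`. -/
def ne (a b : ℕ) : Formula := neg (eq a b)

/-- Extension of a renaming of variables under a quantifier. -/
def liftRen (ρ : ℕ → ℕ) : ℕ → ℕ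
  | 0 => 0
  | n + 1 => ρ n + 1

/-- Simultaneous renaming of the free variables. -/
def rename : (ℕ → ℕ) → Formula → Formula
  | _, falsum => falsum
  | ρ, eq a b => eq (ρ a) (ρ b)
  | ρ, betw a b c => betw (ρ a) (ρ b) (ρ c)
  | ρ, cong a b c d => cong (ρ a) (ρ b) (ρ c) (ρ d)
  | ρ, and φ ψ => rename ρ φ ⋏ rename ρ ψ
  | ρ, or φ ψ => rename ρ φ ⋎ rename ρ ψ
  | ρ, imp φ ψ => rename ρ φ ⇾ rename ρ ψ
  | ρ, all φ => all (rename (liftRen ρ) φ)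
  | ρ, ex φ => ex (rename (liftRen ρ) φ)

/-- Weakening by one fresh variable, which gets the index `0`. -/
def up (φ : Formula) : Formula := rename Nat.succ φ

/-- The substitution that sends the variable `0` to `x` and lowers all other variables. -/
def instRen (x : ℕ) : ℕ → ℕ
  | 0 => x
  | n + 1 => n

/-- The instance `φ(x)` of the body `φ` of a quantified formula. -/
def inst (φ : Formula) (x : ℕ) : Formula := rename (instRen x) φ

end Formula

open Formula in
/-- Natural deduction for intuitionistic first-order logic with equality:
`Derivable Γ φ` says that `φ` is derivable from the assumptions `Γ`.  The language has no function
symbols, so that the terms are the variables. -/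
inductive Derivable : Set Formula → Formula → Prop
  | ax {Γ : Set Formula} {φ : Formula} : φ ∈ Γ → Derivable Γ φ
  | falsumE {Γ : Set Formula} {φ : Formula} : Derivable Γ falsum → Derivable Γ φ
  | andI {Γ : Set Formula} {φ ψ : Formula} :
      Derivable Γ φ → Derivable Γ ψ → Derivable Γ (φ ⋏ ψ)
  | andE₁ {Γ : Set Formula} {φ ψ : Formula} : Derivable Γ (φ ⋏ ψ) → Derivable Γ φ
  | andE₂ {Γ : Set Formula} {φ ψ : Formula} : Derivable Γ (φ ⋏ ψ) → Derivable Γ ψ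
  | orI₁ {Γ : Set Formula} {φ ψ : Formula} : Derivable Γ φ → Derivable Γ (φ ⋎ ψ)
  | orI₂ {Γ : Set Formula} {φ ψ : Formula} : Derivable Γ ψ → Derivable Γ (φ ⋎ ψ)
  | orE {Γ : Set Formula} {φ ψ χ : Formula} :
      Derivable Γ (φ ⋎ ψ) → Derivable (insert φ Γ) χ → Derivable (insert ψ Γ) χ → Derivable Γ χ
  | impI {Γ : Set Formula} {φ ψ : Formula} : Derivable (insert φ Γ) ψ → Derivable Γ (φ ⇾ ψ)
  | impE {Γ : Set Formula} {φ ψ : Formula} :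
      Derivable Γ (φ ⇾ ψ) → Derivable Γ φ → Derivable Γ ψ
  | allI {Γ : Set Formula} {φ : Formula} : Derivable (up '' Γ) φ → Derivable Γ (all φ)
  | allE {Γ : Set Formula} {φ : Formula} (x : ℕ) :
      Derivable Γ (all φ) → Derivable Γ (inst φ x)
  | exI {Γ : Set Formula} {φ : Formula} (x : ℕ) :
      Derivable Γ (inst φ x) → Derivable Γ (ex φ)
  | exE {Γ : Set Formula} {φ χ : Formula} :
      Derivable Γ (ex φ) → Derivable (insert φ (up '' Γ)) (up χ) → Derivable Γ χ
  | eqI {Γ : Set Formula} (x : ℕ) : Derivable Γ (eq x x)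
  | eqE {Γ : Set Formula} {φ : Formula} {x y : ℕ} :
      Derivable Γ (eq x y) → Derivable Γ (inst φ x) → Derivable Γ (inst φ y)

/-! ## Universal closures, written with named variables -/

open Formula

def all2 (f : ℕ → ℕ → Formula) : Formula := all (all (f 1 0))
def all3 (f : ℕ → ℕ → ℕ → Formula) : Formula := all (all (all (f 2 1 0)))
def all4 (f : ℕ → ℕ → ℕ → ℕ → Formula) : Formula := all (all (all (all (f 3 2 1 0))))
def all5 (f : ℕ → ℕ → ℕ → ℕ → ℕ → Formula) : Formula :=
  all (all (all (all (all (f 4 3 2 1 0)))))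
def all6 (f : ℕ → ℕ → ℕ → ℕ → ℕ → ℕ → Formula) : Formula :=
  all (all (all (all (all (all (f 5 4 3 2 1 0))))))
def all8 (f : ℕ → ℕ → ℕ → ℕ → ℕ → ℕ → ℕ → ℕ → Formula) : Formula :=
  all (all (all (all (all (all (all (all (f 7 6 5 4 3 2 1 0))))))))

/-! ## Defined geometric notions -/

/-- Non-strict betweenness `T(a,b,c)`. -/
def tbetw (a b c : ℕ) : Formula := neg (ne a b ⋏ ne b c ⋏ neg (betw a b c))

/-- The points `a`, `b`, `c` are collinear (with no condition that they be distinct). -/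
def col (a b c : ℕ) : Formula := neg (neg (tbetw a b c) ⋏ neg (tbetw b c a) ⋏ neg (tbetw c a b))

/-- `on x a b`: the point `x` lies on `Line(a,b)`; it is used only where `a ≠ b`. -/
def on (x a b : ℕ) : Formula :=
  neg (neg (betw a b x ⋎ betw b x a ⋎ betw x a b ⋎ eq x a ⋎ eq x b))

/-- `ab ≤ cd`: some `e` with `T(c,e,d)` satisfies `ab = ce`. -/
def segLe (a b c d : ℕ) : Formula :=
  ex (tbetw (c + 1) 0 (d + 1) ⋏ cong (a + 1) (b + 1) (c + 1) 0)

/-- `isIntersectLines e a b c d`: `e` is the value of `IntersectLines(Line(a,b), Line(c,d))`, the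
intersection point of two lines that do not coincide.  The two lines are defined only if `a ≠ b` and
`c ≠ d`. -/
def isIntersectLines (e a b c d : ℕ) : Formula :=
  ne a b ⋏ ne c d ⋏ neg (on c a b ⋏ on d a b) ⋏ on e a b ⋏ on e c d

/-! ## Axioms of neutral constructive geometry of the plane -/

/-- Stability of equality. -/
def eqStable : Formula := all2 fun a b => neg (neg (eq a b)) ⇾ eq a b

/-- Stability of betweenness (Markov's principle for betweenness). -/
def betwStable : Formula := all3 fun a b c => neg (neg (betw a b c)) ⇾ betw a b c

/-- Stability of congruence. -/
def congStable : Formula := all4 fun a b c d => neg (neg (cong a b c d)) ⇾ cong a b c d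

def congFlip : Formula := all2 fun a b => cong a b b a

def congTrans : Formula := all6 fun a b p q r s => cong a b p q ⋏ cong a b r s ⇾ cong p q r s

def congIdentity : Formula := all3 fun a b c => cong a b c c ⇾ eq a b

/-- A non-null segment `ab` can be extended by a (possibly null) segment `cd`. -/
def segmentExtension : Formula := all4 fun a b c d =>
  ne a b ⇾ ex (tbetw (a + 1) (b + 1) 0 ⋏ cong (b + 1) 0 (c + 1) (d + 1))

def fiveSegment : Formula := all8 fun a b c d a' b' c' d' =>
  ne a b ⋏ tbetw a b c ⋏ tbetw a' b' c' ⋏ cong a b a' b' ⋏ cong b c b' c' ⋏ cong a d a' d' ⋏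
    cong b d b' d' ⇾ cong c d c' d'

def betwIdentity : Formula := all2 fun a b => neg (betw a b a)

def betwSymm : Formula := all3 fun a b c => betw a b c ⇾ betw c b a

def betwInnerTrans : Formula := all4 fun a b c d => betw a b d ⋏ betw b c d ⇾ betw a b c

def innerPasch : Formula := all5 fun a b c p q =>
  betw a p c ⋏ betw b q c ⋏ neg (col a b c) ⇾
    ex (betw (p + 1) 0 (b + 1) ⋏ betw (q + 1) 0 (a + 1))

def outerPasch : Formula := all5 fun a b c p q =>
  betw a p c ⋏ betw b c q ⋏ neg (col a b q) ⇾
    ex (betw (a + 1) 0 (q + 1) ⋏ betw (b + 1) (p + 1) 0)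

/-- Lower dimension axiom: there are three non-collinear points. -/
def lowerDim : Formula := ex (ex (ex (neg (col 2 1 0))))

/-- Upper dimension axiom: three points equidistant from two distinct points are collinear. -/
def upperDim : Formula := all5 fun a b c p q =>
  ne p q ⋏ cong a p a q ⋏ cong b p b q ⋏ cong c p c q ⇾ col a b c

/-- Line-circle continuity, for the circle with centre `c` through `d` (possibly `c = d`): if `a` is
non-strictly inside and `b` non-strictly outside the circle, then `Line(a,b)` meets the circle in a
point non-strictly between `a` and `b`. -/
def lineCircle : Formula := all4 fun a b c d =>
  ne a b ⋏ segLe c a c d ⋏ segLe c d c b ⇾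
    ex (tbetw (a + 1) 0 (b + 1) ⋏ cong (c + 1) 0 (c + 1) (d + 1))

/-- Circle-circle continuity, for the circles with distinct centres `c`, `k` through `d`, `l`: if
the first circle has a point `u` non-strictly inside and a point `v` non-strictly outside the second,
then some point is on both. -/
def circleCircle : Formula := all6 fun c d k l u v =>
  ne c k ⋏ cong c u c d ⋏ cong c v c d ⋏ segLe k u k l ⋏ segLe k l k v ⇾
    ex (cong (c + 1) 0 (c + 1) (d + 1) ⋏ cong (k + 1) 0 (k + 1) (l + 1))

/-- The axioms of neutral constructive geometry: no parallel postulate. -/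
def neutralAxioms : Set Formula :=
  {eqStable, betwStable, congStable, congFlip, congTrans, congIdentity, segmentExtension,
    fiveSegment, betwIdentity, betwSymm, betwInnerTrans, innerPasch, outerPasch, lowerDim, upperDim,
    lineCircle, circleCircle}

/-! ## The two parallel postulates

In both, `L = Line(s,q)` and `M = Line(p,a)`, so `s ≠ q` and `p ≠ a` are presupposed, and the
variable `0` under the existential quantifier is the point `IntersectLines(L,M)`. -/

/-- The strong parallel postulate; here `K = Line(p,r)`. -/
def strongParallelPostulate : Formula := all6 fun p q r s t a =>
  betw p t q ⋏ betw s t r ⋏ ne s q ⋏ ne p a ⋏ ne p r ⋏ neg (on p s q) ⋏ neg (on a p r) ⋏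
      cong p t q t ⋏ cong r t s t ⇾
    ex (isIntersectLines 0 (s + 1) (q + 1) (p + 1) (a + 1) ⋏
      on 0 (s + 1) (q + 1) ⋏ on 0 (p + 1) (a + 1))

/-- Euclid's Postulate 5. -/
def euclid5 : Formula := all6 fun p q r s t a =>
  betw q a r ⋏ betw p t q ⋏ betw s t r ⋏ cong p t q t ⋏ ne p r ⋏ cong r t s t ⋏
      ne s q ⋏ ne p a ⋏ neg (on p s q) ⇾
    ex (isIntersectLines 0 (s + 1) (q + 1) (p + 1) (a + 1) ⋏
      betw (p + 1) (a + 1) 0 ⋏ betw (s + 1) (q + 1) 0)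

end ConstructiveGeometry

/-! Only one point has to be constructed, the intersection `e`, and SPP supplies it. Everything else
is negative in character: the hypothesis ¬on(a,K) that SPP demands, and the betweennesses B(p,a,e)
and B(s,q,e), which are stable by Markov's principle. It therefore suffices to derive these up to a
double negation, and for that classical geometry is enough.

The transfer is `derivable_neg_neg_of_sat`: if an ∀-free χ holds in all classical models of finitely
many universal closures of ∀-free formulas, then ¬¬χ is derivable intuitionistically. Otherwise ¬χ
is consistent with the assumptions, and a Henkin construction, run with intuitionistic derivability
throughout, gives a countermodel. Glivenko's theorem fails for general ∀, but here universal
quantifiers occur only as outer prefixes of assumptions, where instantiation suffices.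

In a classical model, `p`, `r`, `q`, `s` form a parallelogram with centre `t`. Reflection in `t`
exchanges K and L, so they are disjoint (`parallelogram_disjoint`). As `q` is on L and `r` on K, the
point `a` between them is off K. The two Pasch axioms then put `e` on the correct side
(`betw_of_mem_lines`). The background is Tarski's development of order and congruence, including
Gupta's connectivity theorem (`T_connect`). -/

namespace ConstructiveGeometry

/-! ### Syntax: renamings, fresh variables, countability. -/

namespace Formula

/-- The assignment of `x` to the variable `0` and of `v n` to the variable `n + 1`. -/
def scons {α : Type*} (x : α) (v : ℕ → α) : ℕ → α
  | 0 => x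
  | n + 1 => v n

@[simp] theorem scons_zero {α : Type*} (x : α) (v : ℕ → α) : scons x v 0 = x := rfl

@[simp] theorem scons_succ {α : Type*} (x : α) (v : ℕ → α) (n : ℕ) :
    scons x v (n + 1) = v n := rfl

theorem liftRen_comp (ρ σ : ℕ → ℕ) : liftRen ρ ∘ liftRen σ = liftRen (ρ ∘ σ) := by
  funext n; cases n <;> rfl

theorem rename_rename (φ : Formula) (ρ σ : ℕ → ℕ) :
    rename ρ (rename σ φ) = rename (ρ ∘ σ) φ := by
  induction φ generalizing ρ σ <;> simp_all [rename, liftRen_comp]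

theorem liftRen_id : liftRen id = id := by
  funext n; cases n <;> rfl

theorem rename_id (φ : Formula) : rename id φ = φ := by
  induction φ <;> simp_all [rename, liftRen_id]

theorem rename_inst (φ : Formula) (ρ : ℕ → ℕ) (x : ℕ) :
    rename ρ (inst φ x) = inst (rename (liftRen ρ) φ) (ρ x) := by
  simp only [inst, rename_rename]
  congr 1
  funext n; cases n <;> rfl

theorem inst_rename_liftRen (φ : Formula) (ρ : ℕ → ℕ) (x : ℕ) :
    inst (rename (liftRen ρ) φ) x = rename (scons x ρ) φ := by
  simp only [inst, rename_rename]
  congr 1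
  funext n; cases n <;> rfl

theorem rename_liftRen_up (φ : Formula) (ρ : ℕ → ℕ) :
    rename (liftRen ρ) (up φ) = up (rename ρ φ) := by
  simp only [up, rename_rename]
  rfl

/-- A strict upper bound of the free variables. -/
def bound : Formula → ℕ
  | falsum => 0
  | eq a b => max (a + 1) (b + 1)
  | betw a b c => max (a + 1) (max (b + 1) (c + 1))
  | cong a b c d => max (max (a + 1) (b + 1)) (max (c + 1) (d + 1))
  | and φ ψ => max (bound φ) (bound ψ)
  | or φ ψ => max (bound φ) (bound ψ)
  | imp φ ψ => max (bound φ) (bound ψ)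
  | all φ => bound φ
  | ex φ => bound φ

theorem liftRen_eqOn {ρ σ : ℕ → ℕ} {n : ℕ} (h : ∀ i < n, ρ i = σ i) :
    ∀ i < n, liftRen ρ i = liftRen σ i := by
  rintro (_ | i) hi
  · rfl
  · simp [liftRen, h i (by omega)]

theorem rename_congr (φ : Formula) (ρ σ : ℕ → ℕ) (h : ∀ i < bound φ, ρ i = σ i) :
    rename ρ φ = rename σ φ := by
  induction φ generalizing ρ σ with
  | falsum => rfl
  | eq a b => simp [rename, h a (by simp [bound]), h b (by simp [bound])]
  | betw a b c =>
    simp [rename, h a (by simp [bound]), h b (by simp [bound]), h c (by simp [bound])]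
  | cong a b c d =>
    simp [rename, h a (by simp [bound]), h b (by simp [bound]), h c (by simp [bound]),
      h d (by simp [bound])]
  | and φ ψ ihφ ihψ | or φ ψ ihφ ihψ | imp φ ψ ihφ ihψ =>
    simp only [bound, lt_max_iff] at h
    simp [rename, ihφ ρ σ fun i hi => h i (.inl hi), ihψ ρ σ fun i hi => h i (.inr hi)]
  | all φ ih | ex φ ih => simp [rename, ih _ _ (liftRen_eqOn h)]

/-- An injective numbering of formulas. -/
def code : Formula → ℕ
  | falsum => Nat.pair 0 0
  | eq a b => Nat.pair 1 (Nat.pair a b)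
  | betw a b c => Nat.pair 2 (Nat.pair a (Nat.pair b c))
  | cong a b c d => Nat.pair 3 (Nat.pair a (Nat.pair b (Nat.pair c d)))
  | and φ ψ => Nat.pair 4 (Nat.pair (code φ) (code ψ))
  | or φ ψ => Nat.pair 5 (Nat.pair (code φ) (code ψ))
  | imp φ ψ => Nat.pair 6 (Nat.pair (code φ) (code ψ))
  | all φ => Nat.pair 7 (code φ)
  | ex φ => Nat.pair 8 (code φ)

theorem code_injective : Function.Injective code := by
  intro φ
  induction φ <;> intro ψ h <;> cases ψ <;> simp_all [code, Nat.pair_eq_pair]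
  all_goals grind

instance : Countable Formula := code_injective.countable

/-- No universal quantifier occurs in the formula. -/
def AllFree : Formula → Prop
  | falsum => True
  | eq _ _ => True
  | betw _ _ _ => True
  | cong _ _ _ _ => True
  | and φ ψ => AllFree φ ∧ AllFree ψ
  | or φ ψ => AllFree φ ∧ AllFree ψ
  | imp φ ψ => AllFree φ ∧ AllFree ψ
  | all _ => False
  | ex φ => AllFree φ

/-- The formula is a universal closure of a formula without universal quantifiers. -/
inductive UnivClosure : Formula → Prop
  | base {φ : Formula} : AllFree φ → UnivClosure φ
  | all {φ : Formula} : UnivClosure φ → UnivClosure (all φ)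

end Formula

open Formula

/-! ### Structural properties of derivability. -/

namespace Derivable

theorem mono {Γ Δ : Set Formula} {φ : Formula} (h : Derivable Γ φ) (hΓ : Γ ⊆ Δ) :
    Derivable Δ φ := by
  induction h generalizing Δ with
  | ax h => exact ax (hΓ h)
  | falsumE _ ih => exact falsumE (ih hΓ)
  | andI _ _ ih₁ ih₂ => exact andI (ih₁ hΓ) (ih₂ hΓ)
  | andE₁ _ ih => exact andE₁ (ih hΓ)
  | andE₂ _ ih => exact andE₂ (ih hΓ)
  | orI₁ _ ih => exact orI₁ (ih hΓ)
  | orI₂ _ ih => exact orI₂ (ih hΓ)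
  | orE _ _ _ ih ih₁ ih₂ =>
    exact orE (ih hΓ) (ih₁ (Set.insert_subset_insert hΓ)) (ih₂ (Set.insert_subset_insert hΓ))
  | impI _ ih => exact impI (ih (Set.insert_subset_insert hΓ))
  | impE _ _ ih₁ ih₂ => exact impE (ih₁ hΓ) (ih₂ hΓ)
  | allI _ ih => exact allI (ih (Set.image_mono hΓ))
  | allE x _ ih => exact allE x (ih hΓ)
  | exI x _ ih => exact exI x (ih hΓ)
  | exE _ _ ih₁ ih₂ => exact exE (ih₁ hΓ) (ih₂ (Set.insert_subset_insert (Set.image_mono hΓ)))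
  | eqI x => exact eqI x
  | eqE _ _ ih₁ ih₂ => exact eqE (ih₁ hΓ) (ih₂ hΓ)

theorem image_rename_up (Γ : Set Formula) (ρ : ℕ → ℕ) :
    rename (liftRen ρ) '' (up '' Γ) = up '' (rename ρ '' Γ) := by
  simp only [Set.image_image, rename_liftRen_up]

theorem rename {Γ : Set Formula} {φ : Formula} (h : Derivable Γ φ) (ρ : ℕ → ℕ) :
    Derivable (Formula.rename ρ '' Γ) (Formula.rename ρ φ) := by
  induction h generalizing ρ with
  | ax h => exact ax ⟨_, h, rfl⟩
  | falsumE _ ih => exact falsumE (ih ρ)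
  | andI _ _ ih₁ ih₂ => exact andI (ih₁ ρ) (ih₂ ρ)
  | andE₁ _ ih => exact andE₁ (ih ρ)
  | andE₂ _ ih => exact andE₂ (ih ρ)
  | orI₁ _ ih => exact orI₁ (ih ρ)
  | orI₂ _ ih => exact orI₂ (ih ρ)
  | orE _ _ _ ih ih₁ ih₂ =>
    exact orE (ih ρ) (by simpa [Set.image_insert_eq] using ih₁ ρ)
      (by simpa [Set.image_insert_eq] using ih₂ ρ)
  | impI _ ih => exact impI (by simpa [Set.image_insert_eq] using ih ρ)
  | impE _ _ ih₁ ih₂ => exact impE (ih₁ ρ) (ih₂ ρ)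
  | allI _ ih => exact allI (by simpa only [image_rename_up] using ih (liftRen ρ))
  | allE x _ ih => rw [rename_inst]; exact allE _ (ih ρ)
  | exI x _ ih => exact exI (ρ x) (by simpa only [rename_inst] using ih ρ)
  | exE _ _ ih₁ ih₂ =>
    refine exE (ih₁ ρ) ?_
    simpa only [Set.image_insert_eq, image_rename_up, rename_liftRen_up] using ih₂ (liftRen ρ)
  | eqI x => exact eqI _
  | eqE _ _ ih₁ ih₂ =>
    rw [rename_inst]
    exact eqE (ih₁ ρ) (by simpa only [rename_inst] using ih₂ ρ)

theorem finite_of_insert {Γ Δ : Set Formula} {φ : Formula} (hΔ : Δ ⊆ insert φ Γ)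
    (hfin : Δ.Finite) : ∃ Δ' ⊆ Γ, Δ'.Finite ∧ Δ ⊆ insert φ Δ' :=
  ⟨Δ \ {φ}, by grind, hfin.subset Set.sdiff_subset, by grind⟩

/-- The Henkin set is a directed union of finite consistent sets, so finiteness of derivations makes
it consistent. -/
theorem exists_finite {Γ : Set Formula} {φ : Formula} (h : Derivable Γ φ) :
    ∃ Δ ⊆ Γ, Δ.Finite ∧ Derivable Δ φ := by
  induction h with
  | ax h => exact ⟨{_}, by simpa using h, Set.finite_singleton _, ax rfl⟩
  | falsumE _ ih => obtain ⟨Δ, h, hf, hd⟩ := ih; exact ⟨Δ, h, hf, falsumE hd⟩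
  | andI _ _ ih₁ ih₂ =>
    obtain ⟨Δ₁, h₁, hf₁, hd₁⟩ := ih₁
    obtain ⟨Δ₂, h₂, hf₂, hd₂⟩ := ih₂
    exact ⟨_, Set.union_subset h₁ h₂, hf₁.union hf₂,
      andI (hd₁.mono Set.subset_union_left) (hd₂.mono Set.subset_union_right)⟩
  | andE₁ _ ih => obtain ⟨Δ, h, hf, hd⟩ := ih; exact ⟨Δ, h, hf, andE₁ hd⟩
  | andE₂ _ ih => obtain ⟨Δ, h, hf, hd⟩ := ih; exact ⟨Δ, h, hf, andE₂ hd⟩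
  | orI₁ _ ih => obtain ⟨Δ, h, hf, hd⟩ := ih; exact ⟨Δ, h, hf, orI₁ hd⟩
  | orI₂ _ ih => obtain ⟨Δ, h, hf, hd⟩ := ih; exact ⟨Δ, h, hf, orI₂ hd⟩
  | orE _ _ _ ih ih₁ ih₂ =>
    obtain ⟨Δ, h, hf, hd⟩ := ih
    obtain ⟨Δ₁, h₁, hf₁, hd₁⟩ := ih₁
    obtain ⟨Δ₂, h₂, hf₂, hd₂⟩ := ih₂
    obtain ⟨Θ₁, k₁, kf₁, ks₁⟩ := finite_of_insert h₁ hf₁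
    obtain ⟨Θ₂, k₂, kf₂, ks₂⟩ := finite_of_insert h₂ hf₂
    exact ⟨Δ ∪ (Θ₁ ∪ Θ₂), by grind, hf.union (kf₁.union kf₂),
      orE (hd.mono (by grind)) (hd₁.mono (by grind)) (hd₂.mono (by grind))⟩
  | impI _ ih =>
    obtain ⟨Δ, h, hf, hd⟩ := ih
    obtain ⟨Θ, k, kf, ks⟩ := finite_of_insert h hf
    exact ⟨Θ, k, kf, impI (hd.mono ks)⟩
  | impE _ _ ih₁ ih₂ =>
    obtain ⟨Δ₁, h₁, hf₁, hd₁⟩ := ih₁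
    obtain ⟨Δ₂, h₂, hf₂, hd₂⟩ := ih₂
    exact ⟨_, Set.union_subset h₁ h₂, hf₁.union hf₂,
      impE (hd₁.mono Set.subset_union_left) (hd₂.mono Set.subset_union_right)⟩
  | allI _ ih =>
    obtain ⟨Δ, h, hf, hd⟩ := ih
    obtain ⟨Θ, k, kf, rfl⟩ := Set.exists_subset_image_finite_and.1
      ⟨Δ, h, hf, (rfl : Δ = Δ)⟩
    exact ⟨Θ, k, kf, allI hd⟩
  | allE x _ ih => obtain ⟨Δ, h, hf, hd⟩ := ih; exact ⟨Δ, h, hf, allE x hd⟩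
  | exI x _ ih => obtain ⟨Δ, h, hf, hd⟩ := ih; exact ⟨Δ, h, hf, exI x hd⟩
  | exE _ _ ih₁ ih₂ =>
    obtain ⟨Δ₁, h₁, hf₁, hd₁⟩ := ih₁
    obtain ⟨Δ₂, h₂, hf₂, hd₂⟩ := ih₂
    obtain ⟨Θ, k, kf, ks⟩ := finite_of_insert h₂ hf₂
    obtain ⟨Ξ, l, lf, rfl⟩ := Set.exists_subset_image_finite_and.1
      ⟨Θ, k, kf, (rfl : Θ = Θ)⟩
    exact ⟨_, Set.union_subset h₁ l, hf₁.union lf,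
      exE (hd₁.mono Set.subset_union_left) (hd₂.mono (ks.trans
        (Set.insert_subset_insert (Set.image_mono Set.subset_union_right))))⟩
  | eqI x => exact ⟨∅, Set.empty_subset _, Set.finite_empty, eqI x⟩
  | eqE _ _ ih₁ ih₂ =>
    obtain ⟨Δ₁, h₁, hf₁, hd₁⟩ := ih₁
    obtain ⟨Δ₂, h₂, hf₂, hd₂⟩ := ih₂
    exact ⟨_, Set.union_subset h₁ h₂, hf₁.union hf₂,
      eqE (hd₁.mono Set.subset_union_left) (hd₂.mono Set.subset_union_right)⟩

theorem cut {Γ : Set Formula} {φ ψ : Formula} (h₁ : Derivable Γ φ)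
    (h₂ : Derivable (insert φ Γ) ψ) : Derivable Γ ψ :=
  impE (impI h₂) h₁

/-- A fresh variable can serve as the eigenvariable of an existential elimination. -/
theorem falsum_of_inst {Γ : Set Formula} {φ : Formula} {c : ℕ} (hΓ : ∀ ψ ∈ Γ, bound ψ ≤ c)
    (hφ : bound φ ≤ c) (hex : Derivable Γ (ex φ))
    (h : Derivable (insert (inst φ c) Γ) falsum) : Derivable Γ falsum := by
  refine exE hex ?_
  -- As `c` is fresh, moving `c` to 0 and shifting all else turns the instance back into `φ` and the
  -- context into its weakening, which is the shape `exE` needs.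
  let ρ : ℕ → ℕ := fun n => if n = c then 0 else n + 1
  have hρ : Formula.rename ρ (inst φ c) = φ := by
    rw [inst, rename_rename]
    refine (rename_congr _ _ id ?_).trans (rename_id φ)
    rintro (_ | i) hi
    · simp [instRen, ρ]
    · have : i ≠ c := by omega
      simp [instRen, ρ, this]
  have himg : Formula.rename ρ '' Γ = up '' Γ := by
    refine Set.image_congr fun ψ hψ => rename_congr _ _ _ fun i hi => ?_
    have : i ≠ c := by have := hΓ ψ hψ; omega
    simp [ρ, this]
  have := h.rename ρ
  rwa [Set.image_insert_eq, hρ, himg] at this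

end Derivable

/-! ### Henkin construction and term model. -/

/-- A point set with betweenness and congruence relations. -/
structure Interp (M : Type) where
  betw : M → M → M → Prop
  cong : M → M → M → M → Prop

/-- Classical satisfaction of a formula under an assignment. -/
def Interp.Sat {M : Type} (I : Interp M) : (ℕ → M) → Formula → Prop
  | _, falsum => False
  | v, eq a b => v a = v b
  | v, Formula.betw a b c => I.betw (v a) (v b) (v c)
  | v, Formula.cong a b c d => I.cong (v a) (v b) (v c) (v d)
  | v, Formula.and φ ψ => I.Sat v φ ∧ I.Sat v ψ
  | v, Formula.or φ ψ => I.Sat v φ ∨ I.Sat v ψ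
  | v, imp φ ψ => I.Sat v φ → I.Sat v ψ
  | v, all φ => ∀ x, I.Sat (scons x v) φ
  | v, ex φ => ∃ x, I.Sat (scons x v) φ

/-- A deductively closed, consistent and complete set of formulas with existential witnesses. -/
structure IsHenkin (T : Set Formula) : Prop where
  closed : ∀ {φ}, Derivable T φ → φ ∈ T
  consistent : falsum ∉ T
  complete : ∀ φ, φ ∈ T ∨ neg φ ∈ T
  witness : ∀ {φ}, ex φ ∈ T → ∃ c, inst φ c ∈ T

/-- Finite consistent sets of formulas, ordered by inclusion. -/
abbrev FinCons : Type := {Δ : Set Formula // Δ.Finite ∧ ¬ Derivable Δ falsum}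

/-- A finite consistent set decides `φ`, and provides a witness if `φ` is existential. -/
def Settles (φ : Formula) (Δ : Set Formula) : Prop :=
  (φ ∈ Δ ∨ neg φ ∈ Δ) ∧ ∀ ψ, φ = ex ψ → φ ∈ Δ → ∃ c, inst ψ c ∈ Δ

/-- Intuitionistic logic suffices, since only consistency must be preserved: if `φ` is refutable
then `neg φ` is derivable and may be added. Finiteness of the set guarantees a fresh witness. -/
theorem exists_settles (φ : Formula) (Δ : FinCons) : ∃ Θ : FinCons, Settles φ Θ.1 ∧ Δ ≤ Θ := by
  obtain ⟨Δ, hfin, hcons⟩ := Δ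
  by_cases h : Derivable (insert φ Δ) falsum
  · refine ⟨⟨insert (neg φ) Δ, hfin.insert _, fun h' => hcons (h.impI.cut h')⟩,
      ⟨.inr (Set.mem_insert _ _), ?_⟩, Set.subset_insert _ _⟩
    rintro ψ rfl hmem
    refine absurd ?_ hcons
    rcases hmem with hmem | hmem
    · cases hmem
    · exact h.impI.impE (.ax hmem)
  · by_cases hψ : ∃ ψ, φ = ex ψ
    · obtain ⟨ψ, rfl⟩ := hψ
      have hfin' := hfin.insert (ex ψ)
      obtain ⟨c, hc⟩ := (hfin'.image bound).bddAbove
      have hc' : ∀ χ ∈ insert (ex ψ) Δ, bound χ ≤ c := fun χ hχ => hc ⟨χ, hχ, rfl⟩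
      refine ⟨⟨insert (inst ψ c) (insert (ex ψ) Δ), hfin'.insert _, fun h' => h ?_⟩,
        ⟨.inl (by simp), ?_⟩, (Set.subset_insert _ _).trans (Set.subset_insert _ _)⟩
      · exact Derivable.falsum_of_inst (φ := ψ) hc' (hc' (ex ψ) (Set.mem_insert _ _))
          (.ax (Set.mem_insert _ _)) h'
      · rintro ψ' ⟨⟩ -
        exact ⟨c, Set.mem_insert _ _⟩
    · exact ⟨⟨insert φ Δ, hfin.insert _, h⟩,
        ⟨.inl (Set.mem_insert _ _), fun ψ hφ => absurd ⟨ψ, hφ⟩ hψ⟩, Set.subset_insert _ _⟩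

/-- The Rasiowa–Sikorski lemma: formulas are countable, so one ideal of finite consistent sets meets
every dense set of those settling a given formula. Its union is the required set. -/
theorem exists_isHenkin {Γ : Set Formula} (hfin : Γ.Finite) (hcons : ¬ Derivable Γ falsum) :
    ∃ T, Γ ⊆ T ∧ IsHenkin T := by
  let _ := Encodable.ofCountable Formula
  let D : Formula → Order.Cofinal FinCons := fun φ => ⟨{Θ | Settles φ Θ.1}, exists_settles φ⟩
  let I := Order.idealOfCofinals (⟨Γ, hfin, hcons⟩ : FinCons) D
  let T : Set Formula := {φ | ∃ Θ ∈ I, φ ∈ Θ.1}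
  have hsub : ∀ Δ : Set Formula, Δ.Finite → Δ ⊆ T → ∃ Θ ∈ I, Δ ⊆ Θ.1 := by
    intro Δ hΔ
    induction Δ, hΔ using Set.Finite.induction_on with
    | empty => exact fun _ => ⟨_, Order.mem_idealOfCofinals _ D, Set.empty_subset _⟩
    | insert _ _ ih =>
      intro h
      obtain ⟨Θ₁, h₁, k₁⟩ := ih ((Set.subset_insert _ _).trans h)
      obtain ⟨Θ₂, h₂, k₂⟩ := h (Set.mem_insert _ _)
      obtain ⟨Θ, hΘ, l₁, l₂⟩ := I.directed _ h₁ _ h₂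
      exact ⟨Θ, hΘ, Set.insert_subset (l₂ k₂) (k₁.trans l₁)⟩
  have hTcons : ¬ Derivable T falsum := by
    intro h
    obtain ⟨Δ, hΔ, hf, hd⟩ := h.exists_finite
    obtain ⟨Θ, -, k⟩ := hsub Δ hf hΔ
    exact Θ.2.2 (hd.mono k)
  have hcomplete : ∀ φ, φ ∈ T ∨ neg φ ∈ T := by
    intro φ
    obtain ⟨Θ, hΘ, hI⟩ := Order.cofinal_meets_idealOfCofinals (⟨Γ, hfin, hcons⟩ : FinCons) D φ
    rcases hΘ.1 with h | h
    · exact .inl ⟨Θ, hI, h⟩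
    · exact .inr ⟨Θ, hI, h⟩
  have hΓT : Γ ⊆ T := by
    intro φ hφ
    exact ⟨⟨Γ, hfin, hcons⟩, Order.mem_idealOfCofinals _ D, hφ⟩
  refine ⟨T, hΓT, ?_, ?_, hcomplete, ?_⟩
  · intro φ hφ
    exact (hcomplete φ).resolve_right fun h => hTcons ((Derivable.ax h).impE hφ)
  · exact fun h => hTcons (.ax h)
  · intro φ hφ
    obtain ⟨Θ, hΘ, hI⟩ :=
      Order.cofinal_meets_idealOfCofinals (⟨Γ, hfin, hcons⟩ : FinCons) D (ex φ)
    rcases hΘ.1 with h | h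
    · obtain ⟨c, hc⟩ := hΘ.2 φ rfl h
      exact ⟨c, Θ, hI, hc⟩
    · have hneg : neg (ex φ) ∈ T := ⟨Θ, hI, h⟩
      exact absurd ((Derivable.ax hneg).impE (.ax hφ)) hTcons

namespace IsHenkin

variable {T : Set Formula} (hT : IsHenkin T)
include hT

theorem mem_and {φ ψ : Formula} : (φ ⋏ ψ) ∈ T ↔ φ ∈ T ∧ ψ ∈ T :=
  ⟨fun h => ⟨hT.closed (.andE₁ (.ax h)), hT.closed (.andE₂ (.ax h))⟩,
    fun h => hT.closed (.andI (.ax h.1) (.ax h.2))⟩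

theorem mem_imp {φ ψ : Formula} : (φ ⇾ ψ) ∈ T ↔ (φ ∈ T → ψ ∈ T) := by
  refine ⟨fun h hφ => hT.closed (.impE (.ax h) (.ax hφ)), fun h => ?_⟩
  rcases hT.complete φ with hφ | hφ
  · exact hT.closed (.impI (.ax (.inr (h hφ))))
  · exact hT.closed (.impI (.falsumE (.impE (.ax (.inr hφ)) (.ax (.inl rfl)))))

theorem mem_or {φ ψ : Formula} : (φ ⋎ ψ) ∈ T ↔ φ ∈ T ∨ ψ ∈ T := by
  refine ⟨fun h => ?_, fun h => ?_⟩
  · by_contra! hn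
    have h₁ := (hT.complete φ).resolve_left hn.1
    have h₂ := (hT.complete ψ).resolve_left hn.2
    exact hT.consistent (hT.closed (.orE (.ax h) (.impE (.ax (.inr h₁)) (.ax (.inl rfl)))
      (.impE (.ax (.inr h₂)) (.ax (.inl rfl)))))
  · exact hT.closed (h.elim (fun h => .orI₁ (.ax h)) (fun h => .orI₂ (.ax h)))

theorem mem_ex {φ : Formula} : ex φ ∈ T ↔ ∃ c, inst φ c ∈ T :=
  ⟨hT.witness, fun ⟨c, h⟩ => hT.closed (.exI c (.ax h))⟩

theorem eq_subst (φ : Formula) {x y : ℕ} (h : eq x y ∈ T) (hφ : inst φ x ∈ T) :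
    inst φ y ∈ T :=
  hT.closed (.eqE (.ax h) (.ax hφ))

/-- Provable equality of variables. -/
def setoid : Setoid ℕ where
  r x y := eq x y ∈ T
  iseqv :=
    { refl := fun x => hT.closed (.eqI x)
      symm := fun {x _} h => hT.eq_subst (eq 0 (x + 1)) h (hT.closed (.eqI x))
      trans := fun {x _ _} h h' => hT.eq_subst (eq (x + 1) 0) h' h }

theorem subst {x y : ℕ} (h : (Quotient.mk hT.setoid x) = Quotient.mk hT.setoid y) (φ : Formula)
    (hφ : inst φ x ∈ T) : inst φ y ∈ T :=
  hT.eq_subst φ (Quotient.exact h) hφ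

/-- The term model. -/
def interp : Interp (Quotient hT.setoid) where
  betw x y z := ∃ a b c, Quotient.mk _ a = x ∧ Quotient.mk _ b = y ∧ Quotient.mk _ c = z ∧
    betw a b c ∈ T
  cong x y z w := ∃ a b c d, Quotient.mk _ a = x ∧ Quotient.mk _ b = y ∧ Quotient.mk _ c = z ∧
    Quotient.mk _ d = w ∧ cong a b c d ∈ T

theorem interp_betw (a b c : ℕ) :
    hT.interp.betw (Quotient.mk _ a) (Quotient.mk _ b) (Quotient.mk _ c) ↔ betw a b c ∈ T := by
  refine ⟨?_, fun h => ⟨a, b, c, rfl, rfl, rfl, h⟩⟩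
  rintro ⟨a', b', c', ha, hb, hc, h⟩
  have h₁ := hT.subst ha (betw 0 (b' + 1) (c' + 1)) h
  have h₂ := hT.subst hb (betw (a + 1) 0 (c' + 1)) h₁
  exact hT.subst hc (betw (a + 1) (b + 1) 0) h₂

theorem interp_cong (a b c d : ℕ) :
    hT.interp.cong (Quotient.mk _ a) (Quotient.mk _ b) (Quotient.mk _ c) (Quotient.mk _ d) ↔
      cong a b c d ∈ T := by
  refine ⟨?_, fun h => ⟨a, b, c, d, rfl, rfl, rfl, rfl, h⟩⟩
  rintro ⟨a', b', c', d', ha, hb, hc, hd, h⟩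
  have h₁ := hT.subst ha (cong 0 (b' + 1) (c' + 1) (d' + 1)) h
  have h₂ := hT.subst hb (cong (a + 1) 0 (c' + 1) (d' + 1)) h₁
  have h₃ := hT.subst hc (cong (a + 1) (b + 1) 0 (d' + 1)) h₂
  exact hT.subst hd (cong (a + 1) (b + 1) (c + 1) 0) h₃

theorem scons_mk (c : ℕ) (ρ : ℕ → ℕ) :
    scons (Quotient.mk hT.setoid c) (fun n => Quotient.mk _ (ρ n)) =
      fun n => Quotient.mk _ (scons c ρ n) := by
  funext n; cases n <;> rfl

/-- ∀ is excluded because a complete set containing ¬∀xφ need not contain any ¬φ(c):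
intuitionistically a refuted universal yields no counterexample. -/
theorem sat_iff_mem {φ : Formula} (hφ : AllFree φ) (ρ : ℕ → ℕ) :
    hT.interp.Sat (fun n => Quotient.mk _ (ρ n)) φ ↔ rename ρ φ ∈ T := by
  induction φ generalizing ρ with
  | falsum => exact ⟨False.elim, fun h => hT.consistent h⟩
  | eq a b => exact ⟨fun h => Quotient.exact h, fun h => Quotient.sound h⟩
  | betw a b c => exact hT.interp_betw _ _ _
  | cong a b c d => exact hT.interp_cong _ _ _ _
  | and φ ψ ihφ ihψ => simp [Interp.Sat, rename, hT.mem_and, ihφ hφ.1, ihψ hφ.2]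
  | or φ ψ ihφ ihψ => simp [Interp.Sat, rename, hT.mem_or, ihφ hφ.1, ihψ hφ.2]
  | imp φ ψ ihφ ihψ => simp [Interp.Sat, rename, hT.mem_imp, ihφ hφ.1, ihψ hφ.2]
  | all φ => exact hφ.elim
  | ex φ ih =>
    simp only [Interp.Sat, rename, hT.mem_ex, inst_rename_liftRen, ← ih hφ, ← scons_mk]
    exact Quotient.exists

/-- For a universal prefix only the direction from membership to truth is available; it needs just
instantiation, every element of the term model being named by a variable. -/
theorem sat_of_mem {φ : Formula} (hφ : UnivClosure φ) (ρ : ℕ → ℕ) (h : rename ρ φ ∈ T) :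
    hT.interp.Sat (fun n => Quotient.mk _ (ρ n)) φ := by
  induction hφ generalizing ρ with
  | base hφ => exact (hT.sat_iff_mem hφ ρ).2 h
  | all _ ih =>
    refine Quotient.ind fun c => ?_
    rw [scons_mk]
    refine ih _ ?_
    rw [← inst_rename_liftRen]
    exact hT.closed (.allE c (.ax h))

end IsHenkin

/-- Completeness of classical models for refutations from universal closures of formulas
without universal quantifiers, combined with Glivenko's theorem. -/
theorem derivable_neg_neg_of_sat {Γ : Set Formula} {χ : Formula} (hfin : Γ.Finite)
    (hΓ : ∀ φ ∈ Γ, UnivClosure φ) (hχ : AllFree χ)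
    (h : ∀ (M : Type) (I : Interp M) (v : ℕ → M), (∀ φ ∈ Γ, I.Sat v φ) → I.Sat v χ) :
    Derivable Γ (neg (neg χ)) := by
  by_contra hcons
  obtain ⟨T, hsub, hT⟩ := exists_isHenkin (hfin.insert (neg χ)) fun hd => hcons hd.impI
  have hsat : ∀ φ ∈ T, UnivClosure φ → hT.interp.Sat (fun n => Quotient.mk _ n) φ :=
    fun φ hφ hu => hT.sat_of_mem hu id (by rwa [rename_id])
  have hneg := hsat (neg χ) (hsub (.inl rfl)) (.base ⟨hχ, trivial⟩)
  exact hneg (h _ _ _ fun φ hφ => hsat φ (hsub (.inr hφ)) (hΓ φ hφ))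

/-! ### Classical plane geometry from Tarski-style axioms. -/

namespace Interp

variable {M : Type} (I : Interp M)

/-- Non-strict betweenness. -/
def T (a b c : M) : Prop := a = b ∨ b = c ∨ I.betw a b c

/-- Collinearity. -/
def Col (a b c : M) : Prop := I.T a b c ∨ I.T b c a ∨ I.T c a b

end Interp

/-- A classical model of those axioms of neutral geometry that are needed for elementary
incidence, order and congruence. -/
class NeutralPlane (M : Type) extends Interp M where
  cong_flip (a b : M) : cong a b b a
  cong_trans {a b p q r s : M} : cong a b p q → cong a b r s → cong p q r s
  cong_identity {a b c : M} : cong a b c c → a = b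
  segment_extension {a b : M} (c d : M) : a ≠ b → ∃ x, toInterp.T a b x ∧ cong b x c d
  five_segment {a b c d a' b' c' d' : M} : a ≠ b → toInterp.T a b c → toInterp.T a' b' c' →
    cong a b a' b' → cong b c b' c' → cong a d a' d' → cong b d b' d' → cong c d c' d'
  betw_identity (a b : M) : ¬ betw a b a
  betw_symm {a b c : M} : betw a b c → betw c b a
  betw_inner_trans {a b c d : M} : betw a b d → betw b c d → betw a b c
  inner_pasch {a b c p q : M} : betw a p c → betw b q c → ¬ toInterp.Col a b c →
    ∃ x, betw p x b ∧ betw q x a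
  outer_pasch {a b c p q : M} : betw a p c → betw b c q → ¬ toInterp.Col a b q →
    ∃ x, betw a x q ∧ betw b p x
  exists_ne : ∃ a b : M, a ≠ b

namespace NeutralPlane

variable {M : Type} [NeutralPlane M]

abbrev B (a b c : M) : Prop := NeutralPlane.toInterp.betw a b c
abbrev T (a b c : M) : Prop := NeutralPlane.toInterp.T a b c
abbrev Col (a b c : M) : Prop := NeutralPlane.toInterp.Col a b c

theorem cong_refl (a b : M) : toInterp.cong a b a b :=
  cong_trans (cong_flip b a) (cong_flip b a)

theorem cong_symm {a b c d : M} (h : toInterp.cong a b c d) : toInterp.cong c d a b :=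
  cong_trans h (cong_refl a b)

variable (M) in
/-- Congruence of segments as an equivalence relation on pairs. -/
def congSetoid : Setoid (M × M) where
  r x y := toInterp.cong x.1 x.2 y.1 y.2
  iseqv := ⟨fun _ => cong_refl _ _, cong_symm, fun h h' => cong_trans (cong_symm h) h'⟩

/-- The congruence class of a segment. -/
def len (a b : M) : Quotient (congSetoid M) := Quotient.mk _ (a, b)

theorem len_eq_iff {a b c d : M} : len a b = len c d ↔ toInterp.cong a b c d :=
  ⟨fun h => Quotient.exact h, fun h => Quotient.sound h⟩

theorem len_comm (a b : M) : len a b = len b a := len_eq_iff.2 (cong_flip a b)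

theorem eq_of_len {a b c : M} (h : len a b = len c c) : a = b := cong_identity (len_eq_iff.1 h)

theorem T_left (a b : M) : T a a b := .inl rfl

theorem T_right (a b : M) : T a b b := .inr (.inl rfl)

theorem betw_ne {a b c : M} (h : B a b c) : a ≠ b ∧ b ≠ c ∧ a ≠ c := by
  have key : ∀ x y : M, ¬ B x x y := fun x y h => betw_identity x x (betw_inner_trans h h)
  refine ⟨?_, ?_, ?_⟩
  · rintro rfl; exact key _ _ h
  · rintro rfl; exact key _ _ (betw_symm h)
  · rintro rfl; exact betw_identity _ _ h

theorem T_symm {a b c : M} (h : T a b c) : T c b a := by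
  rcases h with rfl | rfl | h
  · exact T_right _ _
  · exact T_left _ _
  · exact .inr (.inr (betw_symm h))

theorem T_identity {a b : M} (h : T a b a) : a = b := by
  rcases h with rfl | rfl | h
  · rfl
  · rfl
  · exact absurd h (betw_identity a b)

theorem T_inner {a b c d : M} (h : T a b d) (h' : T b c d) : T a b c := by
  rcases h with rfl | rfl | h
  · exact T_left _ _
  · cases T_identity h'; exact T_right _ _
  · rcases h' with rfl | rfl | h'
    · exact T_right _ _
    · exact .inr (.inr h)
    · exact .inr (.inr (betw_inner_trans h h'))

theorem T_exch3 {a b c d : M} (h : T a b c) (h' : T a c d) : T b c d :=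
  T_symm (T_inner (T_symm h') (T_symm h))

/-- Extending a fixed segment ending in `q` by either null segment must return `q`, so both are
congruent to `qq`. -/
theorem len_self (a b : M) : len a a = len b b := by
  obtain ⟨p, q, hpq⟩ := exists_ne (M := M)
  obtain ⟨x, -, hx⟩ := segment_extension a a hpq
  obtain ⟨y, -, hy⟩ := segment_extension b b hpq
  cases cong_identity hx
  cases cong_identity hy
  exact len_eq_iff.2 (cong_trans hx hy)

theorem eq_of_len' {a b c d : M} (h : len a b = len c d) (hcd : c = d) : a = b := by
  subst hcd; exact eq_of_len h

theorem exists_extend (a b c d : M) : ∃ x, T a b x ∧ len b x = len c d := by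
  by_cases hab : a = b
  · subst hab
    obtain ⟨e, he⟩ : ∃ e, e ≠ a := by
      obtain ⟨p, q, hpq⟩ := exists_ne (M := M)
      by_cases h : p = a
      · exact ⟨q, fun h' => hpq (h.trans h'.symm)⟩
      · exact ⟨p, h⟩
    obtain ⟨x, -, hx⟩ := segment_extension c d he
    exact ⟨x, T_left _ _, len_eq_iff.2 hx⟩
  · obtain ⟨x, h, hx⟩ := segment_extension c d hab
    exact ⟨x, h, len_eq_iff.2 hx⟩

theorem five_seg {a b c d a' b' c' d' : M} (hab : a ≠ b) (h : T a b c) (h' : T a' b' c')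
    (h₁ : len a b = len a' b') (h₂ : len b c = len b' c') (h₃ : len a d = len a' d')
    (h₄ : len b d = len b' d') : len c d = len c' d' :=
  len_eq_iff.2 (five_segment hab h h' (len_eq_iff.1 h₁) (len_eq_iff.1 h₂) (len_eq_iff.1 h₃)
    (len_eq_iff.1 h₄))

theorem len_add {a b c a' b' c' : M} (h : T a b c) (h' : T a' b' c')
    (h₁ : len a b = len a' b') (h₂ : len b c = len b' c') : len a c = len a' c' := by
  by_cases hab : a = b
  · cases eq_of_len' h₁.symm hab
    cases hab
    exact h₂
  · have := five_seg hab h h' h₁ h₂ (len_self a a')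
      (by rw [len_comm b, len_comm b', h₁])
    rw [len_comm a, len_comm a', this]

theorem extend_unique {q a x y : M} (hqa : q ≠ a) (hx : T q a x) (hy : T q a y)
    (h : len a x = len a y) : x = y :=
  eq_of_len (five_seg hqa hx hx rfl rfl (len_add hx hy rfl h) h).symm

/-- Lay off `cd` beyond `c` on `ac`; uniqueness of extension from `b` through `c` identifies the new
point with `d`. -/
theorem T_outer {a b c d : M} (h : T a b c) (h' : T b c d) (hbc : b ≠ c) : T a c d := by
  obtain ⟨x, hx, hl⟩ := exists_extend a c c d
  cases extend_unique hbc (T_exch3 h hx) h' hl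
  exact hx

theorem T_outer' {a b c d : M} (h : T a b c) (h' : T b c d) (hbc : b ≠ c) : T a b d :=
  T_symm (T_outer (T_symm h') (T_symm h) hbc.symm)

theorem T_exch2 {a b c d : M} (h : T a b d) (h' : T b c d) : T a c d := by
  by_cases hbc : b = c
  · exact hbc ▸ h
  · exact T_outer (T_inner h h') h' hbc

theorem T_exch4 {a b c d : M} (h : T a b c) (h' : T a c d) : T a b d :=
  T_symm (T_exch2 (T_symm h') (T_symm h))

/-- The axiom covers only strict betweenness and non-collinear points; in the degenerate cases a
given point serves as `x`. -/
theorem pasch {a b c p q : M} (hp : T a p c) (hq : T b q c) :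
    ∃ x, T p x b ∧ T q x a := by
  by_cases hcol : Col a b c
  · rcases hcol with h | h | h
    · exact ⟨b, T_right _ _, T_exch3 (T_symm hq) (T_symm h)⟩
    · exact ⟨c, T_exch3 hp (T_symm h), T_exch3 hq h⟩
    · exact ⟨a, T_exch3 (T_symm hp) h, T_right _ _⟩
  · rcases hp with rfl | rfl | hp
    · exact ⟨a, T_left _ _, T_right _ _⟩
    · exact ⟨q, T_symm hq, T_left _ _⟩
    · rcases hq with rfl | rfl | hq
      · exact ⟨b, T_right _ _, T_left _ _⟩
      · exact ⟨p, T_left _ _, T_symm (.inr (.inr hp))⟩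
      · obtain ⟨x, h₁, h₂⟩ := inner_pasch hp hq hcol
        exact ⟨x, .inr (.inr h₁), .inr (.inr h₂)⟩

/-- Extend `ac` beyond `c` to `e`, apply the five-segment axiom to reach `ed`, then apply it again
backwards from `e`. -/
theorem inner_five_seg {a b c d a' b' c' d' : M} (h : T a b c) (h' : T a' b' c')
    (h₁ : len a c = len a' c') (h₂ : len b c = len b' c') (h₃ : len a d = len a' d')
    (h₄ : len c d = len c' d') : len b d = len b' d' := by
  by_cases hac : a = c
  · cases eq_of_len' h₁.symm hac
    cases hac
    cases T_identity h
    cases T_identity h'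
    exact h₃
  · obtain ⟨e, he, hl⟩ := exists_extend a c a c
    obtain ⟨e', he', hl'⟩ := exists_extend a' c' a c
    have hne : e ≠ c := fun hec => hac (eq_of_len' hl.symm hec.symm)
    have hd := five_seg hac he he' h₁ (hl.trans hl'.symm) h₃ h₄
    exact five_seg hne (T_symm (T_exch3 h he)) (T_symm (T_exch3 h' he'))
      (by rw [len_comm e, len_comm e', hl, hl']) (by rw [len_comm c, len_comm c', h₂]) hd h₄

theorem exists_len_between {a b c a' c' : M} (h : T a b c) (hl : len a c = len a' c') :
    ∃ b', T a' b' c' ∧ len a b = len a' b' ∧ len b c = len b' c' := by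
  by_cases hac : a = c
  · cases eq_of_len' hl.symm hac
    cases hac
    cases T_identity h
    exact ⟨a', T_left _ _, len_self _ _, len_self _ _⟩
  obtain ⟨d, hd, hdl⟩ := exists_extend c' a' a c
  have hda : d ≠ a' := fun hda => hac (eq_of_len' hdl.symm hda.symm)
  obtain ⟨b', hb, hbl⟩ := exists_extend d a' a b
  obtain ⟨x, hx, hxl⟩ := exists_extend d b' b c
  have h₁ := T_exch3 hb hx
  have h₂ := len_add h₁ h hbl hxl
  cases extend_unique hda (T_exch4 hb hx) (T_symm hd) (h₂.trans hl)
  exact ⟨b', h₁, hbl.symm, hxl.symm⟩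

/-- Copy `b` to a point `x` between `a'` and `c'`; since `x` and `b'` have the same distances to
both ends, `x = b'`. -/
theorem T_of_len {a b c a' b' c' : M} (h : T a b c) (h₁ : len a b = len a' b')
    (h₂ : len b c = len b' c') (h₃ : len a c = len a' c') : T a' b' c' := by
  obtain ⟨x, hx, k₁, k₂⟩ := exists_len_between h h₃
  have := inner_five_seg (d := x) (d' := b') hx hx rfl rfl (k₁.symm.trans h₁)
    (by rw [len_comm c', len_comm c', ← k₂, h₂])
  cases eq_of_len this.symm
  exact hx

theorem Col_rot {a b c : M} (h : Col a b c) : Col b c a := by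
  unfold Col Interp.Col at *; tauto

theorem Col_swap {a b c : M} (h : Col a b c) : Col b a c := by
  rcases h with h | h | h
  · exact .inr (.inr (T_symm h))
  · exact .inr (.inl (T_symm h))
  · exact .inl (T_symm h)

theorem Col_of_len {a b c a' b' c' : M} (h : Col a b c) (h₁ : len a b = len a' b')
    (h₂ : len b c = len b' c') (h₃ : len a c = len a' c') : Col a' b' c' := by
  rcases h with h | h | h
  · exact .inl (T_of_len h h₁ h₂ h₃)
  · exact .inr (.inl (T_of_len h h₂ (by rw [len_comm c, len_comm c', h₃])
      (by rw [len_comm b, len_comm b', h₁])))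
  · exact .inr (.inr (T_of_len h (by rw [len_comm c, len_comm c', h₃]) h₁
      (by rw [len_comm c, len_comm c', h₂])))

/-- A point on a line through two points equidistant from `p` and `q` is equidistant from them. -/
theorem len_eq_of_Col {a b c p q : M} (hab : a ≠ b) (h : Col a b c) (ha : len a p = len a q)
    (hb : len b p = len b q) : len c p = len c q := by
  rcases h with h | h | h
  · exact five_seg hab h h rfl rfl ha hb
  · exact inner_five_seg h h rfl rfl hb ha
  · exact five_seg hab.symm (T_symm h) (T_symm h) rfl rfl hb ha

/-- Connectivity of betweenness. -/
theorem T_connect {a b c d : M} (hab : a ≠ b) (hc : T a b c) (hd : T a b d) :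
    T a c d ∨ T a d c := by
  by_cases hbc : b = c
  · subst hbc; exact .inl hd
  by_cases hcd : c = d
  · subst hcd; exact .inl (T_right _ _)
  -- Gupta's construction: `c'` and `d'` overshoot `d` and `c` by `cd`, and the two further
  -- extensions turn out to end in the same point.
  obtain ⟨c', hc', lc'⟩ := exists_extend a d c d
  obtain ⟨d', hd', ld'⟩ := exists_extend a c c d
  obtain ⟨b', hb', lb'⟩ := exists_extend a c' c b
  obtain ⟨b'', hb'', lb''⟩ := exists_extend a d' d b
  have t₁ : T b d c' := T_exch3 hd hc'
  have t₂ : T b c d' := T_exch3 hc hd'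
  have t₃ : T a b c' := T_exch4 hd hc'
  have t₄ : T a b d' := T_exch4 hc hd'
  have t₅ : T b c' b' := T_exch3 t₃ hb'
  have t₆ : T b d' b'' := T_exch3 t₄ hb''
  have t₇ : T c d' b'' := T_exch3 t₂ t₆
  have t₈ : T b c b'' := T_exch4 t₂ t₆
  have l₁ : len b c' = len b'' c :=
    len_add t₁ (T_symm t₇) (by grind [len_comm]) (by grind [len_comm])
  have l₂ : len b b' = len b'' b :=
    len_add t₅ (T_symm t₈) l₁ (by grind [len_comm])
  cases extend_unique hab (T_exch4 t₃ hb') (T_exch4 t₄ hb'') (l₂.trans (len_comm _ _))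
  have t₉ : T d c' b' := T_exch3 t₁ t₅
  have l₃ : len d' c' = len d c :=
    five_seg (d := c') (d' := c) hbc t₂ (T_symm t₉) (by grind [len_comm]) (by grind [len_comm])
      l₁ (len_comm _ _)
  -- The quadrilateral `c d c' d'` has all sides congruent to `cd`, and its diagonals bisect each
  -- other at `e`. The goal follows once one diagonal is null.
  obtain ⟨e, he, he'⟩ := pasch t₉ t₇
  have l₄ : len e c = len e c' :=
    inner_five_seg (T_symm he') (T_symm he') rfl rfl (by grind [len_comm]) (by grind [len_comm])
  have l₅ : len e d = len e d' :=
    inner_five_seg (T_symm he) (T_symm he) rfl rfl ld'.symm (by grind [len_comm])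
  by_cases hcc : c = c'
  · subst hcc; exact .inr hc'
  by_cases hdd : d = d'
  · subst hdd; exact .inl hd'
  exfalso
  -- Assuming both diagonals proper, equidistance from `p` and `q` spreads along lines from `c` and
  -- `r` to `p` itself. Hence `p = q = r`, which forces `e = d'`.
  obtain ⟨p, hp, lp⟩ := exists_extend c' c c d'
  obtain ⟨r, hr, lr⟩ := exists_extend d' c c e
  obtain ⟨q, hq, lq⟩ := exists_extend p r r p
  have hcd' : c ≠ d' := fun h => hcd (eq_of_len' ld'.symm h)
  have hed' : e ≠ d' := fun h => hdd ((eq_of_len' l₅ h).symm.trans h)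
  have hrc : c ≠ r := fun h => by
    have h₁ := eq_of_len' lr.symm h
    exact hcc (h₁.trans (eq_of_len' l₄.symm h₁.symm))
  have l₆ : len r p = len e d' :=
    five_seg (d := p) (d' := d') hcd'.symm hr (T_symm (T_exch3 he hp))
      (by grind [len_comm]) lr (len_comm _ _) lp
  have l₇ : len d c = len q c :=
    five_seg (d := c) (d' := c) hed'.symm he' hq (by grind [len_comm]) (by grind [len_comm])
      (by grind [len_comm]) (by grind [len_comm])
  have k₁ : len c p = len c q := by grind [len_comm]
  have k₂ : len r p = len r q := lq.symm
  have k₃ : len d' p = len d' q := len_eq_of_Col hrc (.inr (.inr hr)) k₁ k₂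
  have k₄ : len b p = len b q := len_eq_of_Col hcd' (.inr (.inr t₂)) k₁ k₃
  have k₅ : len b' p = len b' q := len_eq_of_Col hcd' (.inl t₇) k₁ k₃
  have hbb : b ≠ b' := by
    rintro rfl
    exact hbc (T_identity t₈)
  have k₆ : len c' p = len c' q := len_eq_of_Col hbb (.inr (.inl (T_symm t₅))) k₄ k₅
  have k₇ : len p p = len p q := len_eq_of_Col hcc (.inr (.inr (T_symm hp))) k₁ k₆
  cases eq_of_len k₇.symm
  cases T_identity hq
  exact hed' (eq_of_len l₆.symm)

theorem T_connect_right {a b c d : M} (hab : a ≠ b) (hc : T a b c) (hd : T a b d) :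
    T b c d ∨ T b d c :=
  (T_connect hab hc hd).imp (T_exch3 hc) (T_exch3 hd)

theorem T_connect_inner {a b c d : M} (hb : T a b d) (hc : T a c d) : T a b c ∨ T a c b := by
  by_cases had : a = d
  · cases had
    cases T_identity hb
    exact .inl (T_left _ _)
  obtain ⟨p, hp, lp⟩ := exists_extend d a a d
  have hpa : p ≠ a := fun h => had (eq_of_len' lp.symm h.symm)
  exact T_connect_right hpa (T_inner (T_symm hp) hb) (T_inner (T_symm hp) hc)

theorem Col_trans {a b c d : M} (hab : a ≠ b) (hc : Col a b c) (hd : Col a b d) :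
    Col a c d := by
  rcases hc with hc | hc | hc <;> rcases hd with hd | hd | hd
  · rcases T_connect hab hc hd with h | h
    · exact .inl h
    · exact .inr (.inl (T_symm h))
  · exact .inr (.inl (T_symm (T_exch4 (T_symm hd) hc)))
  · exact .inr (.inr (T_outer' hd hc hab))
  · exact .inl (T_exch4 (T_symm hc) hd)
  · rcases T_connect_inner (T_symm hc) (T_symm hd) with h | h
    · exact .inl h
    · exact .inr (.inl (T_symm h))
  · exact .inr (.inr (T_inner hd (T_symm hc)))
  · exact .inr (.inr (T_symm (T_outer' hc hd hab)))
  · exact .inr (.inr (T_symm (T_inner hc (T_symm hd))))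
  · rcases T_connect_right hab.symm (T_symm hc) (T_symm hd) with h | h
    · exact .inl h
    · exact .inr (.inl (T_symm h))

theorem Col_left (a b : M) : Col a b a := .inr (.inl (T_right _ _))

theorem Col_right (a b : M) : Col a b b := .inl (T_right _ _)

theorem Col_of_betw {a b c : M} (h : B a b c) : Col a b c := .inl (.inr (.inr h))

theorem Col_of_mem_line {a b x y z : M} (hab : a ≠ b) (hx : Col a b x) (hy : Col a b y)
    (hz : Col a b z) : Col x y z := by
  by_cases hax : a = x
  · cases hax; exact Col_trans hab hy hz
  · exact Col_trans (Ne.symm hax) (Col_swap (Col_trans hab hx hy))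
      (Col_swap (Col_trans hab hx hz))

/-- Reflection in a point preserves congruence. -/
theorem len_reflect {p q t x y : M} (hp : T p t q) (lp : len p t = len t q) (hx : T x t y)
    (lx : len x t = len t y) : len p x = len q y := by
  by_cases hpt : p = t
  · cases hpt
    cases eq_of_len' lp.symm rfl
    rw [len_comm, lx]
  -- Lengthen both segments at both ends so that all four new endpoints are at distance `pt + xt`
  -- from `t`; the five-segment axiom then compares them.
  obtain ⟨x₁, hx₁, lx₁⟩ := exists_extend q p x t
  obtain ⟨x₂, hx₂, lx₂⟩ := exists_extend x₁ q x t
  obtain ⟨y₁, hy₁, ly₁⟩ := exists_extend y x p t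
  obtain ⟨y₂, hy₂, ly₂⟩ := exists_extend y₁ y p t
  have t₁ : T x₁ p t := T_inner (T_symm hx₁) hp
  have t₂ : T x₁ t q := T_exch2 (T_symm hx₁) hp
  have t₃ : T x₁ t x₂ := T_exch4 t₂ hx₂
  have t₄ : T t q x₂ := T_exch3 t₂ hx₂
  have t₅ : T y₁ x t := T_inner (T_symm hy₁) hx
  have t₆ : T y₁ t y := T_exch2 (T_symm hy₁) hx
  have t₇ : T y₁ t y₂ := T_exch4 t₆ hy₂
  have t₈ : T t y y₂ := T_exch3 t₆ hy₂
  have l₁ : len x₁ t = len t y₁ :=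
    len_add t₁ (T_symm t₅) (by grind [len_comm]) (by grind [len_comm])
  have l₂ : len x₂ t = len t y₁ :=
    len_add (T_symm t₄) (T_symm t₅) (by grind [len_comm]) (by grind [len_comm])
  have l₃ : len t y₂ = len t y₁ := len_add t₈ (T_symm t₅) (by grind [len_comm])
    (by grind [len_comm])
  have hxt : x₁ ≠ t := fun h => by
    subst h
    exact hpt (T_identity (T_symm t₁)).symm
  have l₄ : len x₂ y₂ = len y₁ x₁ :=
    five_seg (d := y₂) (d' := x₁) hxt t₃ (T_symm t₇) (by grind [len_comm]) (by grind [len_comm])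
      (len_comm _ _) (by grind [len_comm])
  have l₅ : len x x₁ = len y x₂ :=
    inner_five_seg t₅ (T_symm t₈) (by grind [len_comm]) (by grind [len_comm])
      (by grind [len_comm]) (by grind [len_comm])
  exact inner_five_seg t₁ (T_symm t₄) (by grind [len_comm]) (by grind [len_comm])
    (by grind [len_comm]) (by grind [len_comm])

/-- Opposite sides of a parallelogram do not meet. -/
theorem parallelogram_disjoint {p q r s t x : M} (hp : T p t q) (lp : len p t = len t q)
    (hr : T r t s) (lr : len r t = len t s) (hpr : p ≠ r) (hL : ¬ Col p s q) (hx : Col p r x)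
    (hx' : Col s q x) : False := by
  have hsq : s ≠ q := by rintro rfl; exact hL (Col_right _ _)
  -- The reflection `y` of `x` in `t` again lies on both lines, since reflection exchanges them.
  obtain ⟨y, hy, ly⟩ := exists_extend x t x t
  replace ly : len x t = len t y := ly.symm
  have l₁ := len_reflect hp lp hy ly
  have l₂ := len_reflect hr lr hy ly
  have l₃ := len_reflect hp lp hr lr
  have l₄ := len_reflect hp lp (T_symm hy) (by grind [len_comm])
  have l₅ := len_reflect hr lr (T_symm hy) (by grind [len_comm])
  have l₆ := len_reflect hp lp (T_symm hr) (by grind [len_comm])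
  have hy₁ : Col q s y := Col_of_len hx l₃ l₂ l₁
  have hy₂ : Col r p y := Col_of_len hx' (by grind [len_comm]) (by grind [len_comm])
    (by grind [len_comm])
  -- If `x = y` then both equal `t`, so L contains `t` and hence `p`. Otherwise the lines share two
  -- points and coincide.
  by_cases hxy : x = y
  · cases hxy
    cases T_identity hy
    have htq : t ≠ q := by
      rintro rfl
      exact hL (eq_of_len lp ▸ Col_left _ _)
    refine hL (Col_of_mem_line htq ?_ ?_ (Col_right _ _))
    · exact .inr (.inr hp)
    · grind [Col_rot, Col_swap]
  · exact hL (Col_of_mem_line hxy (Col_of_mem_line hpr hx (by grind [Col_rot, Col_swap])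
      (Col_left _ _)) (Col_of_mem_line hsq hx' (by grind [Col_rot, Col_swap]) (Col_left _ _))
      (Col_of_mem_line hsq hx' (by grind [Col_rot, Col_swap]) (Col_right _ _)))

variable {p q r s t a e : M}

/-- If `a` were on K, so would be `q`, which lies on the line through `a` and `r`; but `q` is on L.
-/
theorem not_Col_of_betw (hp : B p t q) (lp : len p t = len t q) (hr : B s t r)
    (lr : len r t = len t s) (hpr : p ≠ r) (hL : ¬ Col p s q) (ha : B q a r) :
    ¬ Col p r a := by
  intro h
  have hc : Col p r q := by
    have := Col_of_betw ha
    exact Col_of_mem_line (betw_ne ha).2.1 (by grind [Col_rot, Col_swap]) (Col_right _ _)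
      (by grind [Col_rot, Col_swap])
  exact parallelogram_disjoint (.inr (.inr hp)) lp (T_symm (.inr (.inr hr))) lr hpr hL hc
    (Col_right _ _)

theorem betw_of_mem_lines (hp : B p t q) (lp : len p t = len t q) (hr : B s t r)
    (lr : len r t = len t s) (hpr : p ≠ r) (hL : ¬ Col p s q) (ha : B q a r)
    (heL : Col s q e) (heM : Col p a e) : B p a e ∧ B s q e := by
  have hdisj : ∀ x, Col p r x → Col s q x → False := fun x =>
    parallelogram_disjoint (.inr (.inr hp)) lp (T_symm (.inr (.inr hr))) lr hpr hL
  have haq := (betw_ne ha).1.symm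
  have hsq : s ≠ q := by rintro rfl; exact hL (Col_right _ _)
  have ca := Col_of_betw ha
  have hqr : ¬ Col s q r := fun h => hdisj r (Col_right _ _) h
  have hpqr : ¬ Col p r q := fun h => hdisj q h (Col_right _ _)
  have haL : ¬ Col s q a := fun h => hqr <| Col_of_mem_line haq (by grind [Col_rot, Col_swap])
    (Col_right _ _) (by grind [Col_rot, Col_swap])
  have hqM : ¬ Col p a q := fun h => hpqr <| Col_of_mem_line haq (by grind [Col_rot, Col_swap])
    (by grind [Col_rot, Col_swap]) (Col_right _ _)
  have hep : e ≠ p := by rintro rfl; grind [Col_rot, Col_swap]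
  have hea : e ≠ a := by rintro rfl; exact haL heL
  have heq : e ≠ q := by rintro rfl; exact hqM heM
  have hpa : p ≠ a := by rintro rfl; exact hpqr (by grind [Col_rot, Col_swap])
  have onL : ∀ {x}, Col e q x → Col s q x := fun h =>
    Col_of_mem_line heq (by grind [Col_rot, Col_swap]) (Col_right _ _) h
  have hpae : B p a e := by
    rcases heM with (h | h | h) | (h | h | h) | (h | h | h)
    · exact absurd h hpa
    · exact absurd h.symm hea
    · exact h
    · exact absurd h.symm hea
    · exact absurd h hep
    -- With `e` between `a` and `p`, the ray from `q` through `e` would leave triangle `p q r`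
    -- through side `pr`, making L meet K.
    · exfalso
      obtain ⟨x, h₁, h₂⟩ := outer_pasch (betw_symm h) ha
        (fun h => hpqr (by grind [Col_rot, Col_swap]))
      have c₁ := Col_of_betw h₁
      have c₂ := Col_of_betw h₂
      exact hdisj x (by grind [Col_rot, Col_swap]) (onL (by grind [Col_rot, Col_swap]))
    · exact absurd h hep
    · exact absurd h hpa
    -- With `p` between `e` and `a`, the line K from `r` through `p` would cross `eq`, a part of L.
    · exfalso
      obtain ⟨x, h₁, h₂⟩ := outer_pasch h (betw_symm ha)
        (fun h => hqr (onL (by grind [Col_rot, Col_swap])))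
      have c₁ := Col_of_betw h₁
      have c₂ := Col_of_betw h₂
      exact hdisj x (by grind [Col_rot, Col_swap]) (onL (by grind [Col_rot, Col_swap]))
  refine ⟨hpae, ?_⟩
  -- The auxiliary point `x` is where `as` crosses `tq`.
  obtain ⟨x, h₁, h₂⟩ := inner_pasch hr ha hqr
  have cp := Col_of_betw hp
  have c₁ := Col_of_betw h₁
  have c₂ := Col_of_betw h₂
  have hpx : p ≠ x := by
    rintro rfl
    exact (betw_ne hp).1 (T_identity (T_inner (.inr (.inr hp)) (.inr (.inr h₁))))
  have cpq : Col p x q := Col_of_mem_line (betw_ne hp).2.1 (by grind [Col_rot, Col_swap])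
    (by grind [Col_rot, Col_swap]) (Col_right _ _)
  have hse : s ≠ e := by
    rintro rfl
    have : Col p a x := Col_of_mem_line (betw_ne h₂).2.2 (by grind [Col_rot, Col_swap])
      (Col_left _ _) (by grind [Col_rot, Col_swap])
    exact hqM (Col_trans hpx (by grind [Col_rot, Col_swap]) cpq)
  -- The line from `p` through `x`, which is the diagonal `pq`, meets `se` in `y`. But that diagonal
  -- meets L only in `q`, so `y = q`.
  obtain ⟨y, h₃, h₄⟩ := outer_pasch (betw_symm h₂) hpae fun h => hL <|
    Col_of_mem_line hse (by grind [Col_rot, Col_swap]) (Col_left _ _)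
      (by grind [Col_rot, Col_swap])
  have c₃ := Col_of_betw h₃
  have c₄ := Col_of_betw h₄
  by_cases hyq : y = q
  · exact hyq ▸ h₃
  · exfalso
    have c₅ : Col p q y := Col_trans hpx cpq c₄
    have c₆ : Col s q y := Col_trans hse (by grind [Col_rot, Col_swap])
      (by grind [Col_rot, Col_swap])
    exact hL (Col_of_mem_line hyq (by grind [Col_rot, Col_swap]) (by grind [Col_rot, Col_swap])
      (Col_right _ _))

end NeutralPlane

/-! ### From satisfaction of the axioms to the classical plane. -/

namespace Interp

variable {M : Type} (I : Interp M)

theorem sat_neg (v : ℕ → M) (φ : Formula) : I.Sat v (neg φ) ↔ ¬ I.Sat v φ := Iff.rfl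

theorem sat_tbetw (v : ℕ → M) (a b c : ℕ) :
    I.Sat v (tbetw a b c) ↔ I.T (v a) (v b) (v c) := by
  simp only [tbetw, ne, sat_neg, Sat, T]
  tauto

theorem sat_col (v : ℕ → M) (a b c : ℕ) :
    I.Sat v (col a b c) ↔ I.Col (v a) (v b) (v c) := by
  simp only [col, sat_neg, Sat, sat_tbetw, Col, not_and_or, not_not]

theorem sat_on (v : ℕ → M) (x a b : ℕ) :
    I.Sat v (on x a b) ↔ I.betw (v a) (v b) (v x) ∨ I.betw (v b) (v x) (v a) ∨
      I.betw (v x) (v a) (v b) ∨ v x = v a ∨ v x = v b := by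
  simp only [on, sat_neg, Sat, not_not]

/-- A classical model of the axioms of neutral constructive geometry is a neutral plane. -/
theorem exists_neutralPlane (v : ℕ → M) (h : ∀ φ ∈ neutralAxioms, I.Sat v φ) :
    ∃ N : NeutralPlane M, N.toInterp = I := by
  simp only [neutralAxioms, Set.mem_insert_iff, Set.mem_singleton_iff, forall_eq_or_imp,
    forall_eq] at h
  obtain ⟨-, -, -, h₁, h₂, h₃, h₄, h₅, h₆, h₇, h₈, h₉, h₁₀, h₁₁, -⟩ := h
  simp only [congFlip, congTrans, congIdentity, segmentExtension, fiveSegment, betwIdentity,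
    betwSymm, betwInnerTrans, innerPasch, outerPasch, lowerDim, all2, all3, all4, all5, all6,
    all8, Sat, sat_neg, sat_tbetw, sat_col, ne] at h₁ h₂ h₃ h₄ h₅ h₆ h₇ h₈ h₉ h₁₀ h₁₁
  refine ⟨
    { I with
      cong_flip := h₁
      cong_trans := fun k k' => h₂ _ _ _ _ _ _ ⟨k, k'⟩
      cong_identity := fun k => h₃ _ _ _ k
      segment_extension := fun c d k => h₄ _ _ c d k
      five_segment := fun k₁ k₂ k₃ k₄ k₅ k₆ k₇ =>
        h₅ _ _ _ _ _ _ _ _ ⟨k₁, k₂, k₃, k₄, k₅, k₆, k₇⟩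
      betw_identity := h₆
      betw_symm := fun k => h₇ _ _ _ k
      betw_inner_trans := fun k k' => h₈ _ _ _ _ ⟨k, k'⟩
      inner_pasch := fun k₁ k₂ k₃ => h₉ _ _ _ _ _ ⟨k₁, k₂, k₃⟩
      outer_pasch := fun k₁ k₂ k₃ => h₁₀ _ _ _ _ _ ⟨k₁, k₂, k₃⟩
      exists_ne := by
        obtain ⟨a, b, c, k⟩ := h₁₁
        exact ⟨a, b, fun hab => k (.inl (.inl hab))⟩ }, rfl⟩

theorem col_of_sat_on {v : ℕ → M} {x a b : ℕ} (h : I.Sat v (on x a b)) :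
    I.Col (v a) (v b) (v x) := by
  rw [sat_on] at h
  rcases h with h | h | h | h | h
  · exact .inl (.inr (.inr h))
  · exact .inr (.inl (.inr (.inr h)))
  · exact .inr (.inr (.inr (.inr h)))
  · exact .inr (.inr (.inl h))
  · exact .inl (.inr (.inl h.symm))

theorem sat_on_of_col {v : ℕ → M} {x a b : ℕ} (hab : v a ≠ v b)
    (h : I.Col (v a) (v b) (v x)) : I.Sat v (on x a b) := by
  rw [sat_on]
  rcases h with (h | h | h) | (h | h | h) | (h | h | h) <;> tauto

end Interp

theorem neutralAxioms_finite : neutralAxioms.Finite := by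
  simp [neutralAxioms]

theorem univClosure_of_mem_neutralAxioms {φ : Formula} (h : φ ∈ neutralAxioms) :
    UnivClosure φ := by
  simp only [neutralAxioms, Set.mem_insert_iff, Set.mem_singleton_iff] at h
  rcases h with h | h | h | h | h | h | h | h | h | h | h | h | h | h | h | h | h <;>
  · subst h
    repeat' apply UnivClosure.all
    apply UnivClosure.base
    simp [AllFree, neg, ne, tbetw, col, segLe, lowerDim]

/-- The axioms are sentences, so they survive unchanged under `allI` and `exE`. -/
theorem up_of_mem_neutralAxioms {φ : Formula} (h : φ ∈ neutralAxioms) : up φ = φ := by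
  simp only [neutralAxioms, Set.mem_insert_iff, Set.mem_singleton_iff] at h
  rcases h with h | h | h | h | h | h | h | h | h | h | h | h | h | h | h | h | h <;>
  · subst h
    rfl

theorem up_image_neutralAxioms : up '' neutralAxioms = neutralAxioms := by
  ext φ
  refine ⟨?_, fun h => ⟨φ, h, up_of_mem_neutralAxioms h⟩⟩
  rintro ⟨ψ, h, rfl⟩
  rwa [up_of_mem_neutralAxioms h]

theorem up_strongParallelPostulate : up strongParallelPostulate = strongParallelPostulate := rfl

/-- The hypotheses of Euclid's Postulate 5. -/
def euclidHyps (p q r s t a : ℕ) : Formula :=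
  betw q a r ⋏ betw p t q ⋏ betw s t r ⋏ cong p t q t ⋏ ne p r ⋏ cong r t s t ⋏
      ne s q ⋏ ne p a ⋏ neg (on p s q)

theorem allFree_euclidHyps (p q r s t a : ℕ) : AllFree (euclidHyps p q r s t a) := by
  simp [euclidHyps, AllFree, neg, ne, on]

/-- Classical consequences of the neutral axioms and one further assumption are derivable up to
a double negation. -/
theorem derivable_neg_neg_of_neutral {ψ χ : Formula} (hψ : AllFree ψ) (hχ : AllFree χ)
    (h : ∀ (M : Type) (I : Interp M) (v : ℕ → M), (∀ φ ∈ neutralAxioms, I.Sat v φ) →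
      I.Sat v ψ → I.Sat v χ) :
    Derivable (insert ψ neutralAxioms) (neg (neg χ)) := by
  refine derivable_neg_neg_of_sat (neutralAxioms_finite.insert _) ?_ hχ ?_
  · rintro φ (rfl | hφ)
    · exact .base hψ
    · exact univClosure_of_mem_neutralAxioms hφ
  · exact fun M I v hI => h M I v (fun φ hφ => hI φ (.inr hφ)) (hI ψ (.inl rfl))

/-- For negated goals the double negation costs nothing; no stability axiom is needed. -/
theorem neg_of_neg_neg_neg {Γ : Set Formula} {φ : Formula}
    (h : Derivable Γ (neg (neg (neg φ)))) : Derivable Γ (neg φ) :=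
  .impI (.impE (h.mono (Set.subset_insert _ _))
    (.impI (.impE (.ax (.inl rfl)) (.ax (.inr (.inl rfl))))))

theorem not_on_derivable (p q r s t a : ℕ) :
    Derivable (insert (euclidHyps p q r s t a) neutralAxioms) (neg (on a p r)) := by
  refine neg_of_neg_neg_neg (derivable_neg_neg_of_neutral (allFree_euclidHyps _ _ _ _ _ _) ?_ ?_)
  · simp [AllFree, neg, on]
  · rintro M I v hI ⟨h₁, h₂, h₃, h₄, h₅, h₆, h₇, -, h₈⟩ hon
    obtain ⟨_, rfl⟩ := I.exists_neutralPlane v hI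
    refine NeutralPlane.not_Col_of_betw (M := M) h₂ ?_ h₃ ?_ h₅ (fun h => h₈ ?_) h₁
      (Interp.col_of_sat_on _ hon)
    · exact (NeutralPlane.len_eq_iff.2 h₄).trans (NeutralPlane.len_comm _ _)
    · exact (NeutralPlane.len_eq_iff.2 h₆).trans (NeutralPlane.len_comm _ _)
    · exact Interp.sat_on_of_col _ h₇ (NeutralPlane.Col_rot h)

theorem betw_derivable (p q r s t a e : ℕ) :
    Derivable (insert (euclidHyps p q r s t a ⋏ isIntersectLines e s q p a) neutralAxioms)
      (neg (neg (betw p a e ⋏ betw s q e))) := by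
  refine derivable_neg_neg_of_neutral ⟨allFree_euclidHyps _ _ _ _ _ _, ?_⟩ ?_ ?_
  · simp [isIntersectLines, AllFree, neg, ne, on]
  · simp [AllFree]
  · rintro M I v hI ⟨⟨h₁, h₂, h₃, h₄, h₅, h₆, h₇, -, h₈⟩, -, -, -, k₁, k₂⟩
    obtain ⟨_, rfl⟩ := I.exists_neutralPlane v hI
    refine NeutralPlane.betw_of_mem_lines (M := M) h₂ ?_ h₃ ?_ h₅ (fun h => h₈ ?_) h₁
      (Interp.col_of_sat_on _ k₁) (Interp.col_of_sat_on _ k₂)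
    · exact (NeutralPlane.len_eq_iff.2 h₄).trans (NeutralPlane.len_comm _ _)
    · exact (NeutralPlane.len_eq_iff.2 h₆).trans (NeutralPlane.len_comm _ _)
    · exact Interp.sat_on_of_col _ h₇ (NeutralPlane.Col_rot h)

theorem betw_of_neg_neg {Γ : Set Formula} {a b c : ℕ} (hΓ : neutralAxioms ⊆ Γ)
    (h : Derivable Γ (neg (neg (betw a b c)))) : Derivable Γ (betw a b c) :=
  .impE (.allE c (.allE b (.allE a (.ax (φ := betwStable) (hΓ (by simp [neutralAxioms])))))) h

theorem neg_neg_mono {Γ : Set Formula} {φ ψ : Formula} (h : Derivable Γ (neg (neg φ)))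
    (hφ : Derivable (insert φ (insert (neg ψ) Γ)) ψ) : Derivable Γ (neg (neg ψ)) :=
  .impI (.impE (h.mono (Set.subset_insert _ _)) (.impI (.impE (.ax (.inr (.inl rfl))) hφ)))

/-! ### The formal derivation of Euclid 5. -/

theorem euclid5_body_derivable :
    Derivable (insert (euclidHyps 5 4 3 2 1 0) (insert strongParallelPostulate neutralAxioms))
      (ex (isIntersectLines 0 3 5 6 1 ⋏ betw 6 1 0 ⋏ betw 3 5 0)) := by
  -- The variables 5, 4, 3, 2, 1, 0 stand for `p`, `q`, `r`, `s`, `t`, `a`; once `e` is introduced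
  -- as 0, each goes up by one.
  have hH := Derivable.ax (Set.mem_insert (euclidHyps 5 4 3 2 1 0)
    (insert strongParallelPostulate neutralAxioms))
  have h₂ := hH.andE₂
  have h₃ := h₂.andE₂
  have h₄ := h₃.andE₂
  have h₅ := h₄.andE₂
  have h₆ := h₅.andE₂
  have h₇ := h₆.andE₂
  have h₈ := h₇.andE₂
  have hspp := ((((((Derivable.ax (Γ := insert (euclidHyps 5 4 3 2 1 0) _)
    (.inr (Set.mem_insert strongParallelPostulate neutralAxioms))).allE 5).allE 4).allE 3).allE
    2).allE 1).allE 0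
  have hon := (not_on_derivable 5 4 3 2 1 0).mono
    (Set.insert_subset_insert (Set.subset_insert strongParallelPostulate _))
  refine .exE (hspp.impE (.andI h₂.andE₁ (.andI h₃.andE₁ (.andI h₇.andE₁ (.andI h₈.andE₁
    (.andI h₅.andE₁ (.andI h₈.andE₂ (.andI hon (.andI h₄.andE₁ h₆.andE₁))))))))) ?_
  rw [Set.image_insert_eq, Set.image_insert_eq, up_image_neutralAxioms]
  set Γ := insert (up (euclidHyps 5 4 3 2 1 0))
    (insert (up strongParallelPostulate) neutralAxioms) with hΓ
  have hint : Derivable (insert (isIntersectLines 0 3 5 6 1 ⋏ on 0 3 5 ⋏ on 0 6 1) Γ)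
    (isIntersectLines 0 3 5 6 1) := .andE₁ (.ax (Set.mem_insert _ _))
  have hax : neutralAxioms ⊆ insert (isIntersectLines 0 3 5 6 1 ⋏ on 0 3 5 ⋏ on 0 6 1) Γ :=
    fun φ hφ => .inr (.inr (.inr hφ))
  have hboth : Derivable (insert (isIntersectLines 0 3 5 6 1 ⋏ on 0 3 5 ⋏ on 0 6 1) Γ)
      (neg (neg (betw 6 1 0 ⋏ betw 3 5 0))) :=
    -- The weakened hypotheses are definitionally `euclidHyps 6 5 4 3 2 1`.
    Derivable.cut (.andI (.ax (.inr (Set.mem_insert (euclidHyps 6 5 4 3 2 1) _))) hint)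
      ((betw_derivable 6 5 4 3 2 1 0).mono (Set.insert_subset_insert hax))
  refine .exI 0 (.andI hint (.andI ?_ ?_))
  -- Markov's principle applies to atoms only, so the doubly negated conjunction is split before it
  -- is used.
  · exact betw_of_neg_neg hax (neg_neg_mono hboth (.andE₁ (.ax (Set.mem_insert _ _))))
  · exact betw_of_neg_neg hax (neg_neg_mono hboth (.andE₂ (.ax (Set.mem_insert _ _))))

end ConstructiveGeometry

theorem mainTheorem6 :
    ConstructiveGeometry.Derivable ConstructiveGeometry.neutralAxioms
      (ConstructiveGeometry.Formula.imp ConstructiveGeometry.strongParallelPostulate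
        ConstructiveGeometry.euclid5) := by
  open ConstructiveGeometry in
  have hup : Formula.up '' insert strongParallelPostulate neutralAxioms =
      insert strongParallelPostulate neutralAxioms := by
    rw [Set.image_insert_eq, up_image_neutralAxioms, up_strongParallelPostulate]
  refine .impI ?_
  unfold ConstructiveGeometry.euclid5 ConstructiveGeometry.all6
  iterate 6 (refine .allI ?_; rw [hup])
  exact .impI ConstructiveGeometry.euclid5_body_derivable
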